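/- Let $\ell\ge 1$. In the neighborhood Lights Out game on a finite simple graph $G$, the vertices carry labels in $\mathbb{Z}/\ell\mathbb{Z}$; toggling a vertex $v$ increases by $1$ the label of $v$ and of every neighbor of $v$, and the game is won when all labels are $0$. Call $G$ \emph{always winnable} if the game can be won from every initial labeling. Let $\max(n,\ell)$ be the maximum number of edges of an always winnable graph on $n$ vertices, and call a graph $(n,\ell)$-\emph{extremal} if it has $n$ vertices, is always winnable, and has exactly $\max(n,\ell)$ edges. For a graph $H$, let $H\odot K_1$ denote the graph obtained from $H$ by adding, for each vertex $v$ of $H$, a new vertex adjacent only to $v$; graphs isomorphic to some $H\odot K_1$ are called \emph{pendant graphs}. Theorem. Let $n$ and $\ell$ be positive even integers, and let $k$ be the smallest nonnegative integer such that $\gcd(n-2k-1,\ell)=1$. If $k\le 3$, then $$\max(n,\ell)=\binom{n}{2}-\left(\frac n2+k\right),$$ and the $(n,\ell)$-extremal graphs are precisely the graphs with $n$ vertices and $\binom{n}{2}-\left(\frac n2+k\right)$ edges whose complement is a pendant graph. -/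

import Mathlib

namespace LightsOut

universe u

/-- Toggling the vertex `v` in the neighborhood Lights Out game on `G` with labels in `ℤ/ℓ`:
the label of each vertex in the closed neighborhood of `v` is increased by `1`. -/
noncomputable def toggle {V : Type u} (G : SimpleGraph V) (ℓ : ℕ)
    (π : V → ZMod ℓ) (v : V) : V → ZMod ℓ :=
  open Classical in fun w => if w = v ∨ G.Adj v w then π w + 1 else π w

/-- The game with initial labeling `π` can be won: some finite sequence of toggles leads from `π`
to the zero labeling. -/
def Winnable {V : Type u} (G : SimpleGraph V) (ℓ : ℕ) (π : V → ZMod ℓ) : Prop :=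
  ∃ s : List V, s.foldl (toggle G ℓ) π = 0

/-- `G` is always winnable (`N`-AW) for labels in `ℤ/ℓ`. -/
def AlwaysWinnable {V : Type u} (G : SimpleGraph V) (ℓ : ℕ) : Prop :=
  ∀ π : V → ZMod ℓ, Winnable G ℓ π

/-- The sizes (numbers of edges) of the always winnable graphs of order `n`. -/
def winnableSizes (n ℓ : ℕ) : Set ℕ :=
  {m | ∃ G : SimpleGraph (Fin n), AlwaysWinnable G ℓ ∧ G.edgeSet.ncard = m}

/-- `max(n,ℓ)`: the maximum size of an always winnable graph of order `n`. -/
noncomputable def maxSize (n ℓ : ℕ) : ℕ := sSup (winnableSizes n ℓ)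

/-- `(n,ℓ)`-extremal graphs: order `n`, always winnable, and of size `max(n,ℓ)`. -/
def IsExtremal {V : Type u} (G : SimpleGraph V) (n ℓ : ℕ) : Prop :=
  Nat.card V = n ∧ AlwaysWinnable G ℓ ∧ G.edgeSet.ncard = maxSize n ℓ

/-- The graph `H ⊙ K₁`: to each vertex `v` of `H` (here `Sum.inl v`) a new vertex (`Sum.inr v`)
is added whose only neighbor is `v`. -/
def corona {W : Type u} (H : SimpleGraph W) : SimpleGraph (W ⊕ W) where
  Adj
    | .inl a, .inl b => H.Adj a b
    | .inl a, .inr b => a = b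
    | .inr a, .inl b => a = b
    | .inr _, .inr _ => False
  symm := ⟨by
    rintro (a | a) (b | b) h
    · exact H.adj_symm h
    · exact Eq.symm h
    · exact Eq.symm h
    · exact h⟩
  loopless := ⟨by
    rintro (a | a) h
    · exact H.irrefl h
    · exact h⟩

/-- Pendant graphs: the graphs of the form `H ⊙ K₁`, up to isomorphism. -/
def IsPendant {V : Type u} (G : SimpleGraph V) : Prop :=
  ∃ (W : Type u) (H : SimpleGraph W), Nonempty (G ≃g corona H)

end LightsOut

namespace LightsOut

open Matrix Finset

universe u

/-! Let `H` be the complement of `G`, with adjacency matrix `A`. The game is linear over `ℤ/ℓ` with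
matrix `J - A`, so `G` is always winnable iff `det (J - A)` is prime to `ℓ` (`alwaysWinnable_iff`).
As `ℓ` is even, this determinant is odd. Modulo 2 and for even order it equals `det A`, whose
Leibniz expansion reduces to involutions; hence `H` has a perfect matching `σ`, and `n/2 + j` edges
for some `j`.

The matching contributes an invertible matrix `M`, and the `j` other edges together with `J` are a
low-rank perturbation. By `det (1 + XY) = det (1 + YX)`, `det A = ±d` and `det (J - A) = ±((1 - n) d
+ t)`, where `d` and `t` depend only on how the `2j` ends of these edges are matched by `σ`
(`abs_det_of_halfEdges`). For `j ≤ 3` a finite check shows that if `d` is odd, then `d = ±1` and `t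
d = 2i` with `0 ≤ i ≤ j`, where `i = j` iff no two ends are matched, i.e. `H` is pendant
(`IsMatched.isBalanced`, `abs_det_gameMatrix`).

So `n - 2i - 1` is prime to `ℓ`, whence `k ≤ i ≤ j`, and `j = k` forces `H` pendant. Conversely, a
pendant `H` with `j = k` has `i = k`. The case `j > 3` already exceeds `k`. -/

/-! ### Integer determinants and bordered matrices -/

/-- The determinant of an integer matrix by Laplace expansion along the first row, in a form that
reduces quickly. -/
def laplaceDet : (n : ℕ) → (Fin n → Fin n → ℤ) → ℤ
  | 0, _ => 1
  | n + 1, A => ∑ j : Fin (n + 1), if A 0 j = 0 then 0 else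
      (-1) ^ (j : ℕ) * A 0 j * laplaceDet n fun p q => A p.succ (j.succAbove q)

theorem laplaceDet_eq_det : ∀ (n : ℕ) (A : Matrix (Fin n) (Fin n) ℤ), laplaceDet n A = A.det
  | 0, A => by simp [laplaceDet]
  | n + 1, A => by
    rw [det_succ_row_zero]
    refine Finset.sum_congr rfl fun j _ => ?_
    split_ifs with h
    · simp [h]
    · rw [← laplaceDet_eq_det n]; rfl

/-- The matrix `A` with a first row `(m, -1, …, -1)` and a first column `(m, 1, …, 1)` added. -/
def border {N : ℕ} (A : Fin N → Fin N → ℤ) (m : ℤ) : Fin (N + 1) → Fin (N + 1) → ℤ :=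
  Fin.cons (Fin.cons m fun _ => -1) fun p => Fin.cons 1 (A p)

/-- The minors along the first row omit the corner, so it enters linearly. In the application only
the corner depends on the order of the graph, which leaves a finite problem. -/
theorem det_border {N : ℕ} (A : Matrix (Fin N) (Fin N) ℤ) (m : ℤ) :
    (of (border A m)).det = m * A.det + (of (border A 0)).det := by
  rw [det_succ_row_zero, det_succ_row_zero (of (border A 0)), Fin.sum_univ_succ, Fin.sum_univ_succ]
  have h : (of (border A m)).submatrix Fin.succ Fin.succ = A := by
    ext p q; simp [border]
  have e (j : Fin (N + 1)) : (of (border A m)).submatrix Fin.succ j.succAbove =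
      (of (border A 0)).submatrix Fin.succ j.succAbove := by
    ext p q; simp [border]
  have h' : (of (border A m)).submatrix Fin.succ (Fin.succAbove 0) = A := by
    simpa using h
  have h0 := e 0
  rw [h'] at h0
  rw [h', ← h0]
  have e' (j : Fin N) := e j.succ
  simp only [border] at e'
  simp [border, e']

/-! ### The finite check on at most three extra edges -/

/-- The other half of the edge to which the half-edge `p` belongs. -/
def mate {j : ℕ} (p : Fin (j * 2)) : Fin (j * 2) :=
  if h : p.val % 2 = 0 then ⟨p + 1, by omega⟩ else ⟨p - 1, by omega⟩

/-- The matrix of the reduced problem on half-edges. -/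
def halfEdgeMatrix {j : ℕ} (c : Fin (j * 2) → Fin (j * 2) → Bool) (p q : Fin (j * 2)) : ℤ :=
  (if p = q then 1 else 0) + if c (mate p) q then 1 else 0

/-- The properties of the relation "the end of `p` is matched to the end of `q`" on half-edges. -/
structure IsMatched {j : ℕ} (c : Fin (j * 2) → Fin (j * 2) → Bool) : Prop where
  symm : ∀ p q, c p q = c q p
  irrefl : ∀ p, c p p = false
  mate : ∀ p, c p (mate p) = false
  trans : ∀ p q r s, c p q → c q r → c r s → c p s
  loopless : ∀ p r, c p r → c (LightsOut.mate p) r = false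

/-- The numerical conclusion on the half-edge matrix. -/
def IsBalanced {j : ℕ} (c : Fin (j * 2) → Fin (j * 2) → Bool) : Prop :=
  let d := laplaceDet _ (halfEdgeMatrix c)
  d % 2 = 1 → let t := laplaceDet _ (border (halfEdgeMatrix c) 0)
    (d = 1 ∨ d = -1) ∧ t % 2 = 0 ∧ 0 ≤ t * d ∧ t * d ≤ 2 * j ∧
      (t * d = 2 * j ↔ ∀ p q, c p q = false)

/-- The iterates `y ↦ 1 - K C y` that approximate the solution of `halfEdgeMatrix c *ᵥ y = 1`. -/
def neumann {j : ℕ} (c : Fin (j * 2) → Fin (j * 2) → Bool) : ℕ → Fin (j * 2) → ℤ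
  | 0, _ => 1
  | n + 1, p => 1 - ∑ q, if c (mate p) q then neumann c n q else 0

/-- A condition that implies `IsBalanced` and is cheaper to decide. -/
def IsBalancedCertified {j : ℕ} (c : Fin (j * 2) → Fin (j * 2) → Bool) : Prop :=
  let d := laplaceDet _ (halfEdgeMatrix c)
  d % 2 = 1 → let s := ∑ p, neumann c 6 p
    (d = 1 ∨ d = -1) ∧ (∀ p, neumann c 7 p = neumann c 6 p) ∧ s % 2 = 0 ∧ 0 ≤ s ∧ s ≤ 2 * j ∧
      (s = 2 * j ↔ ∀ p q, c p q = false)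

instance {j : ℕ} (c : Fin (j * 2) → Fin (j * 2) → Bool) : Decidable (IsBalanced c) := by
  unfold IsBalanced; infer_instance

instance {j : ℕ} (c : Fin (j * 2) → Fin (j * 2) → Bool) : Decidable (IsBalancedCertified c) := by
  unfold IsBalancedCertified; infer_instance

/-- Once a solution `y` is known, a column operation replaces the second determinant; `A` need not
be invertible. -/
theorem det_border_zero {N : ℕ} (A : Matrix (Fin N) (Fin N) ℤ) (y : Fin N → ℤ)
    (hy : A *ᵥ y = fun _ => 1) : (of (border A 0)).det = A.det * ∑ p, y p := by
  -- Right multiplication by `T` subtracts the `y`-combination of the later columns from the first,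
  -- leaving `∑ p, y p` in the corner and zeros below.
  let T : Matrix (Fin (N + 1)) (Fin (N + 1)) ℤ :=
    of (Fin.cons (Fin.cons 1 fun _ => 0) fun p => Fin.cons (-y p) ((1 : Matrix _ _ ℤ) p))
  have hT : T.det = 1 := by
    rw [det_succ_row_zero, Fin.sum_univ_succ]
    have : T.submatrix Fin.succ Fin.succ = 1 := by
      ext p q; simp [T]
    simp [T] at this ⊢
    simp [this]
  have hAT : of (border A 0) * T = of (Fin.cons (Fin.cons (∑ p, y p) fun _ => -1)
      fun p => Fin.cons 0 (A p)) := by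
    ext p q
    have hp (p : Fin N) : ∑ x, A p x * y x = 1 := congrFun hy p
    refine Fin.cases ?_ (fun p => ?_) p <;> refine Fin.cases ?_ (fun q => ?_) q <;>
      rw [mul_apply, Fin.sum_univ_succ]
    · simp [border, T]
    · simp [border, T, one_apply]
    · simp [border, T, hp]
    · simp [border, T, one_apply]
  have h := congrArg det hAT
  rw [det_mul, hT, mul_one] at h
  rw [h, det_succ_column_zero, Fin.sum_univ_succ]
  have : (of (Fin.cons (Fin.cons (∑ p, y p) fun _ => -1) fun p => Fin.cons 0 (A p)) :
      Matrix (Fin (N + 1)) (Fin (N + 1)) ℤ).submatrix Fin.succ Fin.succ = A := by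
    ext p q; simp
  simp at this ⊢
  rw [this, mul_comm]

/-- Two equal consecutive iterates solve the system exactly, so `t = d * s`; with `d = ±1` this
gives `t * d = s`. -/
theorem IsBalancedCertified.isBalanced {j : ℕ} {c : Fin (j * 2) → Fin (j * 2) → Bool}
    (h : IsBalancedCertified c) : IsBalanced c := by
  intro hd t
  set d := laplaceDet _ (halfEdgeMatrix c) with hd'
  obtain ⟨h1, h2, h3, h4, h5, h6⟩ := h hd
  have ht : t = d * ∑ p, neumann c 6 p := by
    have := det_border_zero (of (halfEdgeMatrix c)) (neumann c 6) <| by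
      funext p
      have := h2 p
      rw [neumann] at this
      simp only [mulVec, dotProduct, of_apply, halfEdgeMatrix, add_mul, ite_mul, one_mul, zero_mul,
        Finset.sum_add_distrib, Finset.sum_ite_eq, Finset.mem_univ, if_true]
      linarith
    rwa [← laplaceDet_eq_det, ← laplaceDet_eq_det] at this
  rw [ht, ← h6]
  refine ⟨h1, ?_⟩
  generalize ∑ p, neumann c 6 p = s at *
  rcases h1 with h1 | h1
  · have : d = 1 := h1
    rw [this]
    omega
  · have : d = -1 := h1
    rw [this]
    omega

/-- The given `2 × 2` block has at most one `true` in each row and column. -/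
def blockOK (a b c d : Bool) : Bool := !(a && b) && !(c && d) && !(a && c) && !(b && d)

/-- The relation on six half-edges given by three `2 × 2` blocks. -/
def rel3 (a b c d a' b' c' d' a'' b'' c'' d'' : Bool) : Fin (3 * 2) → Fin (3 * 2) → Bool :=
  ![![false, false, a, b, a', b'],
    ![false, false, c, d, c', d'],
    ![a, c, false, false, a'', b''],
    ![b, d, false, false, c'', d''],
    ![a', c', a'', c'', false, false],
    ![b', d', b'', d'', false, false]]

/-- Each block admits seven values, so at most `7 ^ 3` relations are tested. Those not certified by
the iteration are settled by expanding the bordered determinant. -/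
theorem isBalancedCertified_or_isBalanced_rel3 : ∀ a b c d, blockOK a b c d → ∀ a' b' c' d', blockOK a' b' c' d' →
    ∀ a'' b'' c'' d'', blockOK a'' b'' c'' d'' →
    (∀ p q, rel3 a b c d a' b' c' d' a'' b'' c'' d'' p q →
      ∀ r, rel3 a b c d a' b' c' d' a'' b'' c'' d'' q r →
      ∀ s, rel3 a b c d a' b' c' d' a'' b'' c'' d'' r s →
      rel3 a b c d a' b' c' d' a'' b'' c'' d'' p s) →
    IsBalancedCertified (j := 3) (rel3 a b c d a' b' c' d' a'' b'' c'' d'') ∨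
      IsBalanced (j := 3) (rel3 a b c d a' b' c' d' a'' b'' c'' d'') := by
  decide +kernel

/-- The relation on four half-edges given by a `2 × 2` block. -/
def rel2 (a b c d : Bool) : Fin (2 * 2) → Fin (2 * 2) → Bool :=
  ![![false, false, a, b], ![false, false, c, d], ![a, c, false, false], ![b, d, false, false]]

/-- Transitivity is automatic here: two half-edges of one edge are never both related to the same
half-edge of the other. -/
theorem isBalanced_rel2 : ∀ a b c d, blockOK a b c d →
    IsBalanced (j := 2) (rel2 a b c d) := by
  decide +kernel

theorem isBalanced_rel1 : IsBalanced (j := 1) fun _ _ => false := by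
  decide +kernel

theorem isBalanced_rel0 : IsBalanced (j := 0) fun _ _ => false := by
  decide +kernel

theorem IsMatched.blockOK {j : ℕ} {c : Fin (j * 2) → Fin (j * 2) → Bool} (h : IsMatched c)
    (p q : Fin (j * 2)) :
    blockOK (c p q) (c p (LightsOut.mate q)) (c (LightsOut.mate p) q)
      (c (LightsOut.mate p) (LightsOut.mate q)) := by
  have h1 := h.loopless q p
  have h2 := h.loopless q (LightsOut.mate p)
  have h3 := h.loopless p q
  have h4 := h.loopless p (LightsOut.mate q)
  simp only [h.symm q, h.symm (LightsOut.mate q)] at h1 h2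
  unfold LightsOut.blockOK
  revert h1 h2 h3 h4
  generalize c p q = a
  generalize c p (LightsOut.mate q) = b
  generalize c (LightsOut.mate p) q = d
  generalize c (LightsOut.mate p) (LightsOut.mate q) = e
  revert a b d e
  decide

theorem IsMatched.isBalanced {j : ℕ} (hj : j ≤ 3) {c : Fin (j * 2) → Fin (j * 2) → Bool}
    (h : IsMatched c) : IsBalanced c := by
  interval_cases j
  · have e : c = fun _ _ => false := by
      funext p; exact p.elim0
    rw [e]; exact isBalanced_rel0
  · have e : c = fun _ _ => false := by
      funext p q
      have h0 : c 0 0 = false := h.irrefl 0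
      have h1 : c 1 1 = false := h.irrefl 1
      have h2 : c 0 1 = false := h.mate 0
      have h3 : c 1 0 = false := h.mate 1
      fin_cases p <;> fin_cases q <;> assumption
    rw [e]; exact isBalanced_rel1
  · have e : c = rel2 (c 0 2) (c 0 3) (c 1 2) (c 1 3) := by
      have hi := h.irrefl
      have hm := h.mate
      have hs := h.symm
      funext p q
      fin_cases p <;> fin_cases q <;>
        first | exact hi _ | exact hm 0 | exact hm 1 | exact hm 2 | exact hm 3 | rfl | exact hs _ _
    rw [e]
    exact isBalanced_rel2 _ _ _ _ (h.blockOK 0 2)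
  · have e : c = rel3 (c 0 2) (c 0 3) (c 1 2) (c 1 3) (c 0 4) (c 0 5) (c 1 4) (c 1 5)
        (c 2 4) (c 2 5) (c 3 4) (c 3 5) := by
      have hi := h.irrefl
      have hm := h.mate
      have hs := h.symm
      funext p q
      fin_cases p <;> fin_cases q <;>
        first | exact hi _ | exact hm 0 | exact hm 1 | exact hm 2 | exact hm 3 | exact hm 4 |
          exact hm 5 | rfl | exact hs _ _
    have ht := h.trans
    rw [e] at ht
    rw [e]
    refine Or.elim (isBalancedCertified_or_isBalanced_rel3 _ _ _ _ (h.blockOK 0 2) _ _ _ _ (h.blockOK 0 4) _ _ _ _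
      (h.blockOK 2 4)
      fun p q h1 r h2 s h3 => ht p q r s h1 h2 h3) (fun h => h.isBalanced) id

/-! ### Reduction of the determinants to half-edges -/

/-- If `B` is the adjacency matrix of a graph with perfect matching `σ` and further edges given by
the half-edges `h`, then the determinants of `B` and `J - B` are those of matrices on half-edges. -/
theorem abs_det_of_halfEdges {V : Type*} [Fintype V] [DecidableEq V] {j : ℕ} (σ : V → V)
    (hσ : Function.Involutive σ) (h : Fin (j * 2) → V) (B : Matrix V V ℤ)
    (hB : ∀ v w, B v w = (if w = σ v then 1 else 0) +
      ∑ p, (if v = h p then 1 else 0) * (if w = h (mate p) then 1 else 0)) :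
    let c : Fin (j * 2) → Fin (j * 2) → Bool := fun p q => decide (σ (h p) = h q)
    |B.det| = |laplaceDet _ (halfEdgeMatrix c)| ∧
    |(of (fun _ _ => 1) - B).det| = |(1 - (Fintype.card V : ℤ)) *
        laplaceDet _ (halfEdgeMatrix c) + laplaceDet _ (border (halfEdgeMatrix c) 0)| := by
  intro c
  let M : Matrix V V ℤ := of fun v w => if w = σ v then 1 else 0
  have hMul {m : ℕ} (A : Matrix V (Fin m) ℤ) (v : V) (w : Fin m) :
      (M * A) v w = A (σ v) w := by
    simp [M, mul_apply]
  have hMM : M * M = 1 := by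
    ext v w
    have hMul : (M * M) v w = M (σ v) w := by
      rw [mul_apply, Finset.sum_eq_single (σ v)]
      · simp [M]
      · intro b _ hb
        simp [M, hb]
      · simp
    rw [hMul]
    simp [M, one_apply, hσ v, eq_comm]
  have hM : |M.det| = 1 := by
    have := congrArg det hMM
    rw [det_mul, det_one] at this
    exact Int.isUnit_iff_abs_eq.mp (IsUnit.of_mul_eq_one _ this)
  let L : Matrix V (Fin (j * 2)) ℤ := of fun v p => if v = h p then 1 else 0
  let R : Matrix (Fin (j * 2)) V ℤ := of fun p w => if w = h (mate p) then 1 else 0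
  have hRML (p q) : (R * (M * L)) p q = if c (mate p) q then 1 else 0 := by
    rw [mul_apply]
    simp only [hMul]
    rw [Finset.sum_eq_single (h (mate p))]
    · simp [R, L, c]
    · intro b _ hb
      simp [R, hb]
    · simp
  -- The extra column of ones in `L'` and row of `-1` in `R'` contribute `-J`, so `L' * R' = L * R -
  -- J`.
  let L' : Matrix V (Fin (j * 2 + 1)) ℤ := of fun v => Fin.cons 1 (L v)
  let R' : Matrix (Fin (j * 2 + 1)) V ℤ := of (Fin.cons (fun _ => -1) R)
  have hR0 (w : V) : R' 0 w = -1 := rfl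
  have hRs (p : Fin (j * 2)) (w : V) : R' p.succ w = R p w := rfl
  have hBeq : B = M * (1 + M * L * R) := by
    rw [mul_add, mul_one, Matrix.mul_assoc M, ← Matrix.mul_assoc M M, hMM, Matrix.one_mul]
    ext v w
    rw [hB]
    simp [M, L, R, mul_apply]
  have hJeq : of (fun _ _ => (1 : ℤ)) - B = -(M * (1 + M * L' * R')) := by
    rw [mul_add, mul_one, Matrix.mul_assoc M, ← Matrix.mul_assoc M M, hMM, Matrix.one_mul]
    ext v w
    simp only [Matrix.neg_apply, Matrix.sub_apply, Matrix.add_apply, mul_apply, Fin.sum_univ_succ, hR0, hRs]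
    simp [hB, M, L, R, L']
    ring
  have hX : 1 + R * (M * L) = of (halfEdgeMatrix c) := by
    ext p q
    simp only [Matrix.add_apply, hRML, one_apply, halfEdgeMatrix, of_apply]
  have hX' : 1 + R' * (M * L') = of (border (halfEdgeMatrix c) (1 - (Fintype.card V : ℤ))) := by
    ext p q
    refine Fin.cases ?_ (fun p => ?_) p <;> refine Fin.cases ?_ (fun q => ?_) q
    · rw [Matrix.add_apply, mul_apply]
      simp only [hMul]
      simp [hR0, L', border]; ring
    · have : ∑ x, (if σ x = h q then (-1 : ℤ) else 0) = -1 := by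
        rw [Finset.sum_eq_single (σ (h q))] <;> simp [hσ (h q)]
        intro b hb hb'; exact absurd (by rw [← hb', hσ]) hb
      rw [Matrix.add_apply, mul_apply]
      simp only [hMul]
      simp [hR0, L', L, border, this, one_apply, (Fin.succ_ne_zero q).symm]
    · rw [Matrix.add_apply, mul_apply]
      simp only [hMul]
      simp [L', hRs, R, border, one_apply]
    · have := congrFun (congrFun hX p) q
      rw [Matrix.add_apply, mul_apply] at this ⊢
      simp only [of_apply, one_apply, hMul] at this ⊢
      simp only [border, hRs, Fin.cons_succ, ← this, Fin.succ_inj]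
      simp [L']
  refine ⟨?_, ?_⟩
  · rw [hBeq, det_mul, abs_mul, hM, one_mul, det_one_add_mul_comm, hX, ← laplaceDet_eq_det]; rfl
  · rw [hJeq, det_neg, abs_mul, abs_pow, abs_neg, abs_one, one_pow, one_mul, det_mul, abs_mul, hM,
      one_mul, det_one_add_mul_comm, hX']
    have := det_border (of (halfEdgeMatrix c)) (1 - (Fintype.card V : ℤ))
    rw [← laplaceDet_eq_det _ (of (halfEdgeMatrix c)),
      ← laplaceDet_eq_det _ (of (border (of (halfEdgeMatrix c)) 0))] at this
    exact congrArg _ this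

/-! ### Symmetric determinants modulo 2 -/

/-- By symmetry `τ` and `τ⁻¹` give equal Leibniz terms, which cancel in characteristic 2 unless `τ`
is an involution. -/
theorem exists_involutive_of_det_ne_zero {V : Type*} [Fintype V] [DecidableEq V]
    (A : Matrix V V (ZMod 2)) (hA : ∀ v w, A v w = A w v) (hdet : A.det ≠ 0) :
    ∃ σ : V → V, Function.Involutive σ ∧ ∀ v, A v (σ v) ≠ 0 := by
  by_contra! hno
  apply hdet
  rw [det_apply]
  refine Finset.sum_involution (fun τ _ => τ⁻¹) (fun τ _ => ?_) (fun τ _ h0 h1 => ?_)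
    (fun _ _ => Finset.mem_univ _) (fun τ _ => inv_inv τ)
  · have : ∏ i, A (τ⁻¹ i) i = ∏ i, A (τ i) i := by
      rw [← Equiv.prod_comp τ]
      simp [hA]
    rw [this, Equiv.Perm.sign_inv]
    exact CharTwo.add_self_eq_zero _
  · have hinv : Function.Involutive τ := fun v => by
      have : (τ⁻¹ * τ) v = v := by rw [inv_mul_cancel]; rfl
      rwa [h1] at this
    obtain ⟨v, hv⟩ := hno τ hinv
    apply h0
    rw [Finset.prod_eq_zero (Finset.mem_univ v) (by rw [hA]; exact hv), smul_zero]

theorem even_card_of_involutive {V : Type*} [Fintype V] (σ : V → V) (hσ : Function.Involutive σ)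
    (h : ∀ v, σ v ≠ v) : Even (Fintype.card V) := by
  classical
  rw [← ZMod.natCast_eq_zero_iff_even]
  have : ∑ _v : V, (1 : ZMod 2) = 0 :=
    Finset.sum_involution (fun v _ => σ v) (fun _ _ => by decide) (fun v _ _ => h v)
      (fun _ _ => Finset.mem_univ _) (fun v _ => hσ v)
  simpa using this

/-- Border `A` by ones. With corner 0 the matrix is symmetric of odd order with zero diagonal, hence
singular, since an involution of an odd set has a fixed point. With corner 1 the Schur complement
gives `det (A - J)`, while linearity in the first row gives `0 + det A`. -/
theorem det_allOnes_sub_zmod_two {V : Type*} [Fintype V] [DecidableEq V]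
    (hV : Even (Fintype.card V)) (A : Matrix V V (ZMod 2)) (hA : ∀ v w, A v w = A w v)
    (hd : ∀ v, A v v = 0) : (of (fun _ _ => 1) - A).det = A.det := by
  let r : Matrix Unit V (ZMod 2) := of fun _ _ => 1
  let c : Matrix V Unit (ZMod 2) := of fun _ _ => 1
  have h0 : (fromBlocks 0 r c A).det = 0 := by
    by_contra h
    obtain ⟨σ, hσ, hne⟩ := exists_involutive_of_det_ne_zero _ (fun v w => by
      rcases v with v | v <;> rcases w with w | w <;> first | exact hA _ _ | simp [r, c]) h
    have := even_card_of_involutive σ hσ fun v hv => by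
      have := hne v
      rw [hv] at this
      rcases v with v | v
      · simp at this
      · simp [hd] at this
    rw [Fintype.card_sum, Fintype.card_unit] at this
    exact absurd hV (by simpa [parity_simps] using this)
  have h1 : (fromBlocks 1 r c A).det = (A - of fun _ _ => 1).det := by
    rw [det_fromBlocks_one₁₁]
    congr 2
  have h2 : fromBlocks 1 r c A = (fromBlocks 0 r c A).updateRow (Sum.inl ())
      (fromBlocks 0 r c A (Sum.inl ()) + fromBlocks 1 0 c A (Sum.inl ())) := by
    ext v w
    rcases v with v | v <;> rcases w with w | w <;> simp [updateRow_apply]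
  have h3 : (fromBlocks 0 r c A).updateRow (Sum.inl ()) (fromBlocks 1 0 c A (Sum.inl ())) =
      fromBlocks 1 0 c A := by
    ext v w
    rcases v with v | v <;> rcases w with w | w <;> simp [updateRow_apply]
  rw [h2, det_updateRow_add, updateRow_eq_self, h0, h3, det_fromBlocks_zero₁₂, det_one, zero_add,
    one_mul] at h1
  rw [h1, ← neg_sub A, det_neg, hV.neg_one_pow, one_mul]

/-! ### The game as a linear system, and perfect matchings -/

/-- The matrix of the neighborhood Lights Out game on the complement of `H`. -/
noncomputable def gameMatrix {V : Type*} (H : SimpleGraph V) : Matrix V V ℤ :=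
  open Classical in of (fun _ _ => 1) - H.adjMatrix ℤ

/-- Only the number of toggles of each vertex matters; `gameMatrix Gᶜ` is the identity plus the
adjacency matrix of `G`. -/
theorem foldl_toggle {V : Type*} [Fintype V] [DecidableEq V] (G : SimpleGraph V) (ℓ : ℕ)
    (s : List V) (π : V → ZMod ℓ) :
    s.foldl (toggle G ℓ) π =
      π + ((gameMatrix Gᶜ).map (Int.cast : ℤ → ZMod ℓ)) *ᵥ fun v => (s.count v : ZMod ℓ) := by
  induction s generalizing π with
  | nil =>
    simp only [List.foldl_nil, List.count_nil, Nat.cast_zero, left_eq_add]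
    exact mulVec_zero _
  | cons a s ih =>
    rw [List.foldl_cons, ih]
    have h1 : toggle G ℓ π a =
        π + ((gameMatrix Gᶜ).map (Int.cast : ℤ → ZMod ℓ)) *ᵥ Pi.single a 1 := by
      funext w
      simp only [toggle, Pi.add_apply, mulVec_single_one, col_apply, map_apply, gameMatrix,
        Matrix.sub_apply, of_apply, SimpleGraph.adjMatrix_apply, SimpleGraph.compl_adj]
      by_cases hw : w = a
      · simp [hw]
      · by_cases h : G.Adj a w
        · simp [hw, h, h.symm]
        · have : ¬ G.Adj w a := fun h' => h h'.symm
          simp [hw, h, this]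
    rw [h1, add_assoc, ← mulVec_add]
    congr 2
    funext v
    rw [List.count_cons]
    by_cases h : a = v
    · subst h; simp [add_comm]
    · simp [h, Ne.symm h]

theorem alwaysWinnable_iff {V : Type*} [Fintype V] [DecidableEq V] (G : SimpleGraph V) (ℓ : ℕ)
    (hℓ : 0 < ℓ) : AlwaysWinnable G ℓ ↔ Int.gcd (gameMatrix Gᶜ).det ℓ = 1 := by
  have : NeZero ℓ := ⟨hℓ.ne'⟩
  have h1 : AlwaysWinnable G ℓ ↔
      Function.Surjective ((gameMatrix Gᶜ).map (Int.cast : ℤ → ZMod ℓ)).mulVec := by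
    constructor
    · intro h y
      obtain ⟨s, hs⟩ := h (-y)
      rw [foldl_toggle] at hs
      exact ⟨_, (neg_add_eq_zero.mp hs).symm⟩
    · intro h π
      obtain ⟨x, hx⟩ := h (-π)
      -- Toggle each `v` as often as the least nonnegative representative of `x v`.
      refine ⟨(∑ v, Multiset.replicate (x v).val v).toList, ?_⟩
      rw [foldl_toggle]
      have : (fun v => (((∑ v, Multiset.replicate (x v).val v).toList.count v : ℕ) : ZMod ℓ)) =
          x := by
        funext v
        rw [← Multiset.coe_count, Multiset.coe_toList, Multiset.count_sum']
        simp [Multiset.count_replicate]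
      rw [this, hx, add_neg_cancel]
  rw [h1, mulVec_surjective_iff_isUnit, isUnit_iff_isUnit_det]
  have : ((gameMatrix Gᶜ).map (Int.cast : ℤ → ZMod ℓ)).det =
      (((gameMatrix Gᶜ).det : ℤ) : ZMod ℓ) := by
    rw [Int.cast_det]
  rw [this, ← Int.isCoprime_iff_gcd_eq_one, ZMod.coe_int_isUnit_iff_isCoprime, isCoprime_comm]

theorem odd_det_adjMatrix {V : Type*} [Fintype V] [DecidableEq V] (H : SimpleGraph V)
    [DecidableRel H.Adj] (hV : Even (Fintype.card V)) (h : Odd (gameMatrix H).det) :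
    Odd (H.adjMatrix ℤ).det := by
  rw [← ZMod.intCast_eq_one_iff_odd, Int.cast_det] at h ⊢
  have e : (gameMatrix H).map (Int.cast : ℤ → ZMod 2) =
      of (fun _ _ => 1) - (H.adjMatrix ℤ).map (Int.cast : ℤ → ZMod 2) := by
    ext v w
    simp [gameMatrix, SimpleGraph.adjMatrix_apply]
  rw [e, det_allOnes_sub_zmod_two hV] at h
  · exact h
  · intro v w; simp [SimpleGraph.adj_comm]
  · simp

theorem exists_perfect_matching {V : Type*} [Fintype V] [DecidableEq V] (H : SimpleGraph V)
    (hV : Even (Fintype.card V)) (h : Odd (gameMatrix H).det) :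
    ∃ σ : V → V, Function.Involutive σ ∧ ∀ v, H.Adj v (σ v) := by
  classical
  have h1 := odd_det_adjMatrix H hV h
  rw [← ZMod.intCast_eq_one_iff_odd, Int.cast_det] at h1
  obtain ⟨σ, hσ, hne⟩ := exists_involutive_of_det_ne_zero
    ((H.adjMatrix ℤ).map (Int.cast : ℤ → ZMod 2)) (fun v w => by simp [SimpleGraph.adj_comm]) (by rw [h1]; exact one_ne_zero)
  refine ⟨σ, hσ, fun v => ?_⟩
  by_contra hv
  exact hne v (by simp [hv])

/-! ### Listing the edges outside the matching -/

theorem mate_val {j : ℕ} (p : Fin (j * 2)) :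
    (mate p : ℕ) = if (p : ℕ) % 2 = 0 then (p : ℕ) + 1 else p - 1 := by
  unfold mate
  split_ifs <;> rfl

theorem mate_mate {j : ℕ} (p : Fin (j * 2)) : mate (mate p) = p := by
  ext
  rw [mate_val, mate_val]
  split_ifs <;> omega

theorem mate_finProdFinEquiv {j : ℕ} (i : Fin j) :
    mate (finProdFinEquiv (i, (0 : Fin 2))) = finProdFinEquiv (i, (1 : Fin 2)) := by
  ext
  simp [mate, finProdFinEquiv, add_comm]

/-- The edges outside a perfect matching, listed as pairs of half-edges. -/
theorem exists_halfEdges {V : Type*} [Fintype V] [DecidableEq V] (H : SimpleGraph V)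
    [DecidableRel H.Adj] (σ : V → V) (hσ : Function.Involutive σ) (hadj : ∀ v, H.Adj v (σ v)) :
    ∃ (j : ℕ) (h : Fin (j * 2) → V), H.edgeSet.ncard * 2 = Fintype.card V + j * 2 ∧
      (∀ v w, H.adjMatrix ℤ v w = (if w = σ v then 1 else 0) +
        ∑ p, (if v = h p then 1 else 0) * (if w = h (mate p) then 1 else 0)) ∧
      ∀ p, H.Adj (h p) (h (mate p)) ∧ h (mate p) ≠ σ (h p) := by
  let F := H.edgeFinset.filter fun e => ∀ v w, e = s(v, w) → w ≠ σ v
  have hF (v w : V) : s(v, w) ∈ F ↔ H.Adj v w ∧ w ≠ σ v := by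
    simp only [F, Finset.mem_filter, SimpleGraph.mem_edgeFinset, SimpleGraph.mem_edgeSet]
    refine and_congr_right fun _ => ⟨fun h => h v w rfl, fun h v' w' e => ?_⟩
    rcases Sym2.eq_iff.mp e with ⟨rfl, rfl⟩ | ⟨rfl, rfl⟩
    · exact h
    · rintro rfl
      exact h (hσ _).symm
  let e : Fin F.card ≃ F := F.equivFin.symm
  let a (i : Fin F.card) : V × V := (e i).1.out
  have ha (i : Fin F.card) : s((a i).1, (a i).2) = (e i).1 := Quot.out_eq (e i).1
  have haF (i : Fin F.card) : H.Adj (a i).1 (a i).2 ∧ (a i).2 ≠ σ (a i).1 := by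
    rw [← hF, ha]
    exact (e i).2
  let h (p : Fin (F.card * 2)) : V :=
    if (finProdFinEquiv.symm p).2 = 0 then (a (finProdFinEquiv.symm p).1).1
    else (a (finProdFinEquiv.symm p).1).2
  have h0 (i : Fin F.card) : h (finProdFinEquiv (i, (0 : Fin 2))) = (a i).1 := by
    simp only [h, Equiv.symm_apply_apply, if_true]
  have h1 (i : Fin F.card) : h (finProdFinEquiv (i, (1 : Fin 2))) = (a i).2 := by
    simp only [h, Equiv.symm_apply_apply, one_ne_zero, if_false]
  have hm1 (i : Fin F.card) : mate (finProdFinEquiv (i, (1 : Fin 2))) =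
      finProdFinEquiv (i, (0 : Fin 2)) := by
    rw [← mate_finProdFinEquiv, mate_mate]
  have hB : ∀ v w, H.adjMatrix ℤ v w = (if w = σ v then 1 else 0) +
        ∑ p, (if v = h p then 1 else 0) * (if w = h (mate p) then 1 else 0) := by
    intro v w
    rw [← finProdFinEquiv.sum_comp, Fintype.sum_prod_type]
    simp only [Fin.sum_univ_two, mate_finProdFinEquiv, hm1, h0, h1]
    have hterm (i : Fin F.card) : ((if v = (a i).1 then 1 else 0) * (if w = (a i).2 then 1 else 0) +
        (if v = (a i).2 then 1 else 0) * (if w = (a i).1 then 1 else 0) : ℤ) =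
        if s(v, w) = (e i).1 then 1 else 0 := by
      rw [← ha]
      have := (haF i).1.ne
      simp only [Sym2.eq_iff]
      by_cases h1 : v = (a i).1 <;> by_cases h2 : w = (a i).2 <;>
        by_cases h3 : v = (a i).2 <;> by_cases h4 : w = (a i).1 <;> simp_all
    simp only [hterm]
    rw [e.sum_comp (fun x : F => if s(v, w) = x.1 then (1 : ℤ) else 0),
      Finset.sum_coe_sort F (fun x => if s(v, w) = x then (1 : ℤ) else 0), Finset.sum_ite_eq,
      SimpleGraph.adjMatrix_apply]
    simp only [hF]
    by_cases hw : w = σ v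
    · subst hw; simp [hadj]
    · simp [hw]
  refine ⟨F.card, h, ?_, hB, fun p => ?_⟩
  -- The sum of all entries of the adjacency matrix is computed in two ways.
  · have hs : ∑ v, ∑ w, H.adjMatrix ℤ v w = (H.edgeSet.ncard * 2 : ℕ) := by
      have := H.sum_degrees_eq_twice_card_edges
      rw [← SimpleGraph.coe_edgeFinset, Set.ncard_coe_finset, mul_comm, ← this]
      simp [SimpleGraph.adjMatrix_apply, SimpleGraph.neighborFinset_eq_filter,
        ← SimpleGraph.card_neighborFinset_eq_degree]
    have ht : ∑ v, ∑ w, H.adjMatrix ℤ v w = (Fintype.card V + F.card * 2 : ℕ) := by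
      simp only [hB, Finset.sum_add_distrib]
      have (v : V) : ∑ w, ∑ p, ((if v = h p then 1 else 0) * (if w = h (mate p) then 1 else 0) : ℤ)
          = ∑ p, if v = h p then 1 else 0 := by
        rw [Finset.sum_comm]
        simp
      simp only [this]
      rw [Finset.sum_comm (f := fun v p => if v = h p then (1 : ℤ) else 0)]
      simp
    exact_mod_cast hs.symm.trans ht
  · obtain ⟨⟨i, b⟩, rfl⟩ := finProdFinEquiv.surjective p
    obtain rfl | rfl : b = 0 ∨ b = 1 := by omega
    · rw [mate_finProdFinEquiv, h0, h1]
      exact haF i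
    · rw [hm1, h0, h1]
      exact ⟨(haF i).1.symm, fun h => (haF i).2 (by rw [h, hσ])⟩

/-! ### Pendant graphs as matchings with a leaf on every edge -/

/-- The involution `σ` matches each vertex along an edge of `H`, one end of which is a leaf. -/
structure IsLeafMatching {V : Type u} (H : SimpleGraph V) (σ : V → V) : Prop where
  involutive : Function.Involutive σ
  adj : ∀ v, H.Adj v (σ v)
  leaf : ∀ v, (∀ w, H.Adj v w → w = σ v) ∨ ∀ w, H.Adj (σ v) w → w = v

theorem IsLeafMatching.isPendant {V : Type u} [Finite V] {H : SimpleGraph V} {σ : V → V}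
    (h : IsLeafMatching H σ) : IsPendant H := by
  obtain ⟨hσ, hadj, hleaf⟩ := h
  obtain ⟨n, ⟨e⟩⟩ := Finite.exists_equiv_fin V
  let T (v : V) : Prop := ∃ w, H.Adj v w ∧ w ≠ σ v
  -- `S` takes one end of each matching edge: the end that is not a leaf, or the smaller one in the
  -- enumeration `e` if both are leaves.
  let S : Set V := {v | T v ∨ ¬ T (σ v) ∧ e v < e (σ v)}
  have hT (v : V) (h1 : T v) (h2 : T (σ v)) : False := by
    obtain ⟨w, hw, hw'⟩ := h1
    obtain ⟨w2, hw2, hw2'⟩ := h2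
    rw [hσ] at hw2'
    rcases hleaf v with h | h
    · exact hw' (h w hw)
    · exact hw2' (h w2 hw2)
  have hS1 (v : V) (h1 : v ∈ S) (h2 : σ v ∈ S) : False := by
    simp only [S, Set.mem_ofPred_eq, hσ v] at h1 h2
    rcases h1 with h1 | ⟨h1, h1'⟩ <;> rcases h2 with h2 | ⟨h2, h2'⟩
    · exact hT v h1 h2
    · exact h2 h1
    · exact h1 h2
    · exact lt_asymm h1' h2'
  have hS2 (v : V) (h1 : v ∉ S) : σ v ∈ S := by
    simp only [S, Set.mem_ofPred_eq, hσ v, not_or, not_and] at h1 ⊢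
    by_cases h2 : T (σ v)
    · exact Or.inl h2
    · refine Or.inr ⟨h1.1, lt_of_le_of_ne (not_lt.mp (h1.2 h2)) fun h => ?_⟩
      exact (hadj v).ne (e.injective h).symm
  have hS3 (v w : V) (h1 : v ∉ S) (h : H.Adj v w) : w = σ v := by
    by_contra hw
    exact h1 (Or.inl ⟨w, h, hw⟩)
  have hS4 (v : V) (h : v ∈ S) : σ v ∉ S := hS1 v h
  let f : S ⊕ S → V := Sum.elim (fun x => x) (fun x => σ x)
  have hf : Function.Bijective f := by
    constructor
    · rintro (x | x) (y | y) hxy <;> simp only [f, Sum.elim_inl, Sum.elim_inr] at hxy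
      · rw [Subtype.ext hxy]
      · exact absurd (hxy ▸ x.2) (hS4 y y.2)
      · exact absurd (hxy ▸ y.2) (hS4 x x.2)
      · rw [Subtype.ext (hσ.injective hxy)]
    · intro v
      by_cases hv : v ∈ S
      · exact ⟨Sum.inl ⟨v, hv⟩, rfl⟩
      · exact ⟨Sum.inr ⟨σ v, hS2 v hv⟩, hσ v⟩
  refine ⟨S, H.induce S, ⟨(RelIso.mk (Equiv.ofBijective f hf) ?_ : corona (H.induce S) ≃g H).symm⟩⟩
  rintro (x | x) (y | y) <;> simp only [Equiv.ofBijective_apply, f, Sum.elim_inl, Sum.elim_inr]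
  · rfl
  · change H.Adj x (σ y) ↔ x = y
    constructor
    · intro h
      have := hS3 _ _ (hS4 y y.2) h.symm
      rw [hσ] at this
      exact Subtype.ext this
    · rintro rfl
      exact hadj x
  · change H.Adj (σ x) y ↔ x = y
    constructor
    · intro h
      have := hS3 _ _ (hS4 x x.2) h
      rw [hσ] at this
      exact Subtype.ext this.symm
    · rintro rfl
      exact (hadj x).symm
  · change H.Adj (σ x) (σ y) ↔ False
    refine iff_false_intro fun h => ?_
    have := hS3 _ _ (hS4 x x.2) h
    rw [hσ] at this
    exact hS4 y y.2 (this ▸ x.2)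

theorem isLeafMatching_corona {W : Type u} (H : SimpleGraph W) :
    IsLeafMatching (corona H) Sum.swap := by
  refine ⟨Sum.swap_swap, ?_, ?_⟩
  · rintro (a | a) <;> exact rfl
  · rintro (a | a)
    · right
      rintro (b | b) h
      · exact congrArg Sum.inl (Eq.symm h)
      · exact False.elim h
    · left
      rintro (b | b) h
      · exact congrArg Sum.inl (Eq.symm h)
      · exact False.elim h

theorem IsPendant.exists_isLeafMatching {V : Type u} {H : SimpleGraph V} (h : IsPendant H) :
    ∃ σ, IsLeafMatching H σ := by
  obtain ⟨W, K, ⟨φ⟩⟩ := h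
  obtain ⟨h1, h2, h3⟩ := isLeafMatching_corona K
  refine ⟨fun v => φ.symm (φ v).swap, fun v => by simp, fun v => ?_, fun v => ?_⟩
  · rw [← φ.map_adj_iff]
    simpa using h2 (φ v)
  · refine (h3 (φ v)).imp (fun h w hw => ?_) fun h w hw => ?_
    · rw [← h (φ w) (φ.map_adj_iff.mpr hw), φ.symm_apply_apply]
    · rw [← φ.map_adj_iff] at hw
      simpa using h (φ w) (by simpa using hw)

/-! ### The determinant of the game matrix -/

/-- With at most three edges outside a perfect matching and an odd determinant, the determinant of
the game matrix is `±(n - 2i - 1)`, where `i` is maximal exactly for pendant graphs. -/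
theorem abs_det_gameMatrix {V : Type u} [Fintype V] [DecidableEq V] (H : SimpleGraph V)
    [DecidableRel H.Adj] (σ : V → V) (hσ : Function.Involutive σ) (hadj : ∀ v, H.Adj v (σ v))
    {j : ℕ} (hj : j ≤ 3) (hE : H.edgeSet.ncard * 2 = Fintype.card V + j * 2)
    (hodd : Odd (H.adjMatrix ℤ).det ∨ IsLeafMatching H σ) :
    ∃ i ≤ j, |(gameMatrix H).det| = |(Fintype.card V : ℤ) - 2 * i - 1| ∧
      (i = j ↔ IsLeafMatching H σ) := by
  obtain ⟨j', h, hE', hB, hmate⟩ := exists_halfEdges H σ hσ hadj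
  obtain rfl : j' = j := by omega
  obtain ⟨hdet, hgame⟩ := abs_det_of_halfEdges σ hσ h _ hB
  set c : Fin (j' * 2) → Fin (j' * 2) → Bool := fun p q => decide (σ (h p) = h q) with hc
  have hc' (p q) : c p q = true ↔ σ (h p) = h q := by simp [hc]
  have hM : IsMatched c := by
    constructor
    · intro p q
      rw [Bool.eq_iff_iff, hc', hc', hσ.eq_iff, eq_comm]
    · intro p
      rw [Bool.eq_false_iff, ne_eq, hc']
      exact (hadj _).ne'
    · intro p
      rw [Bool.eq_false_iff, ne_eq, hc']
      exact (hmate p).2.symm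
    · intro p q r s h1 h2 h3
      rw [hc'] at *
      rw [h1, ← h3, ← h2, hσ]
    · intro p r h1
      rw [Bool.eq_false_iff, ne_eq, hc']
      rw [hc'] at h1
      intro h2
      exact (hmate p).1.ne (hσ.injective (h1.trans h2.symm))
  have hleaf : (∀ p q, c p q = false) ↔ IsLeafMatching H σ := by
    constructor
    · intro h0
      refine ⟨hσ, hadj, fun v => ?_⟩
      by_contra! hv
      obtain ⟨⟨w, hw, hw'⟩, w2, hw2, hw2'⟩ := hv
      have key (x y : V) (hxy : H.Adj x y) (hne : y ≠ σ x) : ∃ p, x = h p := by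
        by_contra! hx
        have := hB x y
        simp [hxy, hne, hx] at this
      obtain ⟨p, hp⟩ := key v w hw hw'
      obtain ⟨q, hq⟩ := key (σ v) w2 hw2 (by rwa [hσ])
      have := h0 p q
      rw [Bool.eq_false_iff, ne_eq, hc', ← hp, ← hq] at this
      exact this rfl
    · intro hL p q
      rw [Bool.eq_false_iff, ne_eq, hc']
      intro hpq
      rcases hL.leaf (h p) with h1 | h1
      · exact (hmate p).2 (h1 _ (hmate p).1)
      · rw [hpq] at h1
        apply (hmate q).2
        rw [h1 _ (hmate q).1, ← hpq, hσ]
  have hbal := hM.isBalanced hj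
  unfold IsBalanced at hbal
  rw [hleaf] at hbal
  -- For a leaf matching no half-edges are related, the matrix is the identity, and `d = 1`.
  have hd : laplaceDet _ (halfEdgeMatrix c) % 2 = 1 := by
    rcases hodd with hodd | hL
    · rw [← odd_abs, hdet, odd_abs] at hodd
      exact Int.odd_iff.mp hodd
    · have h0 := hleaf.mpr hL
      have : halfEdgeMatrix c = (1 : Matrix (Fin (j' * 2)) (Fin (j' * 2)) ℤ) := by
        ext p q
        simp [halfEdgeMatrix, h0, one_apply]
      rw [this, laplaceDet_eq_det, det_one]
      rfl
  obtain ⟨h1, h2, h3, h4, h5⟩ := hbal hd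
  have hgM : gameMatrix H = of (fun _ _ => 1) - H.adjMatrix ℤ := by
    unfold gameMatrix
    congr
  rw [hgM, hgame]
  generalize laplaceDet _ (halfEdgeMatrix c) = d at *
  generalize laplaceDet _ (border (halfEdgeMatrix c) 0) = t at *
  -- Since `d = ±1`, `|(1 - n) d + t| = |n - t d - 1|`, so `2 i = t d`.
  refine ⟨(t * d / 2).toNat, ?_, ?_, ?_⟩
  · omega
  · rcases h1 with rfl | rfl
    · rw [← abs_neg]
      congr 1
      omega
    · congr 1
      omega
  · rw [← h5]
    rcases h1 with rfl | rfl <;> omega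

/-! ### Edge counts and extremal graphs -/

theorem ncard_edgeSet_add_compl {V : Type u} [Finite V] (G : SimpleGraph V) :
    G.edgeSet.ncard + Gᶜ.edgeSet.ncard = (Nat.card V).choose 2 := by
  classical
  have := Fintype.ofFinite V
  rw [Nat.card_eq_fintype_card, ← SimpleGraph.card_edgeFinset_top_eq_card_choose_two,
    ← Set.ncard_union_eq (SimpleGraph.disjoint_edgeSet.mpr disjoint_compl_right),
    ← SimpleGraph.edgeSet_sup, sup_compl_eq_top, ← SimpleGraph.coe_edgeFinset,
    Set.ncard_coe_finset]

theorem exists_index_of_alwaysWinnable {V : Type u} [Finite V] {G : SimpleGraph V} {ℓ : ℕ}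
    (hℓ0 : 0 < ℓ) (hℓ : Even ℓ) (hV : Even (Nat.card V)) (hG : AlwaysWinnable G ℓ) :
    ∃ j, Gᶜ.edgeSet.ncard * 2 = Nat.card V + j * 2 ∧ (j ≤ 3 → ∃ i ≤ j,
      Int.gcd ((Nat.card V : ℤ) - 2 * i - 1) ℓ = 1 ∧ (i = j → IsPendant Gᶜ)) := by
  classical
  have := Fintype.ofFinite V
  rw [Nat.card_eq_fintype_card] at *
  rw [alwaysWinnable_iff G ℓ hℓ0] at hG
  have hodd : Odd (gameMatrix Gᶜ).det := by
    rw [← Int.not_even_iff_odd]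
    intro h
    have h2 : (2 : ℤ) ∣ (Int.gcd (gameMatrix Gᶜ).det ℓ : ℤ) :=
      Int.dvd_coe_gcd h.two_dvd (by exact_mod_cast hℓ.two_dvd)
    rw [hG] at h2
    omega
  obtain ⟨σ, hσ, hadj⟩ := exists_perfect_matching _ hV hodd
  obtain ⟨j, -, hE, -⟩ := exists_halfEdges Gᶜ σ hσ hadj
  refine ⟨j, hE, fun hj => ?_⟩
  obtain ⟨i, hij, hdet, hi⟩ := abs_det_gameMatrix Gᶜ σ hσ hadj hj hE
    (Or.inl (odd_det_adjMatrix _ hV hodd))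
  refine ⟨i, hij, ?_, fun h => (hi.mp h).isPendant⟩
  rw [← hG, Int.gcd, Int.gcd, Int.natAbs_eq_natAbs_iff.mpr (abs_eq_abs.mp hdet)]

theorem alwaysWinnable_of_isPendant {V : Type u} [Finite V] {G : SimpleGraph V} {ℓ k : ℕ}
    (hℓ0 : 0 < ℓ) (hk : k ≤ 3) (hE : Gᶜ.edgeSet.ncard * 2 = Nat.card V + k * 2)
    (hG : IsPendant Gᶜ) (hgcd : Int.gcd ((Nat.card V : ℤ) - 2 * k - 1) ℓ = 1) :
    AlwaysWinnable G ℓ := by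
  classical
  have := Fintype.ofFinite V
  rw [Nat.card_eq_fintype_card] at *
  rw [alwaysWinnable_iff G ℓ hℓ0]
  obtain ⟨σ, hσ⟩ := hG.exists_isLeafMatching
  obtain ⟨i, -, hdet, hi⟩ := abs_det_gameMatrix Gᶜ σ hσ.involutive hσ.adj hk hE (Or.inr hσ)
  obtain rfl := hi.mpr hσ
  rw [← hgcd, Int.gcd, Int.gcd, Int.natAbs_eq_natAbs_iff.mpr (abs_eq_abs.mp hdet)]

theorem exists_ncard_edgeSet (m k : ℕ) (h : k ≤ m.choose 2) :
    ∃ H : SimpleGraph (Fin m), H.edgeSet.ncard = k := by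
  have h' : k ≤ (⊤ : SimpleGraph (Fin m)).edgeFinset.card := by
    rwa [SimpleGraph.card_edgeFinset_top_eq_card_choose_two, Fintype.card_fin]
  obtain ⟨t, ht, rfl⟩ := Finset.exists_subset_card_eq h'
  refine ⟨SimpleGraph.fromEdgeSet t, ?_⟩
  rw [SimpleGraph.edgeSet_fromEdgeSet, ← Set.ncard_coe_finset]
  congr 1
  rw [sdiff_eq_left, Set.disjoint_left]
  intro e he hd
  have := ht he
  rw [SimpleGraph.mem_edgeFinset] at this
  exact SimpleGraph.not_isDiag_of_mem_edgeSet _ this hd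

theorem ncard_edgeSet_corona {W : Type u} [Finite W] (H : SimpleGraph W) :
    (corona H).edgeSet.ncard = H.edgeSet.ncard + Nat.card W := by
  classical
  have := Fintype.ofFinite W
  have h1 := (corona H).sum_degrees_eq_twice_card_edges
  have h2 := H.sum_degrees_eq_twice_card_edges
  have d1 (a : W) : (corona H).degree (Sum.inl a) = H.degree a + 1 := by
    have : (corona H).neighborFinset (Sum.inl a) =
        (H.neighborFinset a).disjSum {a} := by
      ext (b | b)
      · rw [SimpleGraph.mem_neighborFinset, Finset.inl_mem_disjSum, SimpleGraph.mem_neighborFinset]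
        rfl
      · rw [SimpleGraph.mem_neighborFinset, Finset.inr_mem_disjSum, Finset.mem_singleton, eq_comm]
        rfl
    rw [← SimpleGraph.card_neighborFinset_eq_degree, this, Finset.card_disjSum]
    simp
  have d2 (a : W) : (corona H).degree (Sum.inr a) = 1 := by
    have : (corona H).neighborFinset (Sum.inr a) = {Sum.inl a} := by
      ext (b | b)
      · rw [SimpleGraph.mem_neighborFinset, Finset.mem_singleton, Sum.inl.injEq, eq_comm]
        rfl
      · rw [SimpleGraph.mem_neighborFinset, Finset.mem_singleton]
        exact iff_of_false id (by simp)
    rw [← SimpleGraph.card_neighborFinset_eq_degree, this, Finset.card_singleton]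
  rw [Fintype.sum_sum_type] at h1
  simp only [d1, d2, Finset.sum_add_distrib, h2, Finset.sum_const, Finset.card_univ] at h1
  rw [Nat.card_eq_fintype_card, ← SimpleGraph.coe_edgeFinset, ← SimpleGraph.coe_edgeFinset,
    Set.ncard_coe_finset, Set.ncard_coe_finset]
  simp only [smul_eq_mul, mul_one] at h1
  omega

theorem exists_isPendant (m k : ℕ) (h : k ≤ m.choose 2) :
    ∃ H : SimpleGraph (Fin (m + m)), IsPendant H ∧ H.edgeSet.ncard = k + m := by
  obtain ⟨K, hK⟩ := exists_ncard_edgeSet m k h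
  let φ : (corona K).map finSumFinEquiv.toEmbedding ≃g corona K :=
    (SimpleGraph.Iso.map finSumFinEquiv (corona K)).symm
  refine ⟨_, ⟨Fin m, K, ⟨φ⟩⟩, ?_⟩
  rw [← Nat.card_coe_set_eq, Nat.card_congr φ.mapEdgeSet, Nat.card_coe_set_eq,
    ncard_edgeSet_corona, hK, Nat.card_fin]

/-- The possible sizes of the complement of an always winnable graph of even order. -/
theorem le_ncard_edgeSet_compl {V : Type u} [Finite V] {G : SimpleGraph V} {m ℓ k : ℕ}
    (hℓ0 : 0 < ℓ) (hℓ : Even ℓ)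
    (hk : IsLeast {j : ℕ | Int.gcd (((m + m : ℕ) : ℤ) - 2 * (j : ℤ) - 1) (ℓ : ℤ) = 1} k)
    (hk3 : k ≤ 3) (hV : Nat.card V = m + m) (hG : AlwaysWinnable G ℓ) :
    m + k ≤ Gᶜ.edgeSet.ncard ∧ (Gᶜ.edgeSet.ncard = m + k → IsPendant Gᶜ) := by
  obtain ⟨j, hE, hj⟩ := exists_index_of_alwaysWinnable hℓ0 hℓ (hV ▸ ⟨m, rfl⟩) hG
  rw [hV] at hE hj
  by_cases h3 : j ≤ 3
  · obtain ⟨i, hij, hgcd, hP⟩ := hj h3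
    have hki : k ≤ i := hk.2 hgcd
    exact ⟨by omega, fun h => hP (by omega)⟩
  · exact ⟨by omega, fun h => by omega⟩

end LightsOut

open LightsOut in
theorem mainTheorem1 (n ℓ k : ℕ) (hn0 : 0 < n) (hℓ0 : 0 < ℓ) (hn : Even n) (hℓ : Even ℓ)
    (hk : IsLeast {j : ℕ | Int.gcd ((n : ℤ) - 2 * (j : ℤ) - 1) (ℓ : ℤ) = 1} k) (hk3 : k ≤ 3) :
    IsGreatest (LightsOut.winnableSizes n ℓ) (LightsOut.maxSize n ℓ) ∧
    (LightsOut.maxSize n ℓ : ℚ) = (n.choose 2 : ℚ) - ((n : ℚ) / 2 + (k : ℚ)) ∧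
    ∀ (V : Type*) [Finite V] (G : SimpleGraph V),
      LightsOut.IsExtremal G n ℓ ↔
        Nat.card V = n ∧ LightsOut.IsPendant Gᶜ ∧
          (G.edgeSet.ncard : ℚ) = (n.choose 2 : ℚ) - ((n : ℚ) / 2 + (k : ℚ)) := by
  obtain ⟨m, rfl⟩ := hn
  have hkm : k < m := by
    -- The index `m - 1` gives `n - 2 (m - 1) - 1 = 1`, prime to every `ℓ`.
    have : m - 1 ∈ {j : ℕ | Int.gcd (((m + m : ℕ) : ℤ) - 2 * (j : ℤ) - 1) (ℓ : ℤ) = 1} := by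
      have e : ((m + m : ℕ) : ℤ) - 2 * ((m - 1 : ℕ) : ℤ) - 1 = 1 := by omega
      rw [Set.mem_ofPred_eq, e]
      simp
    have := hk.2 this
    omega
  -- `k ≤ (k + 1).choose 2 ≤ m.choose 2`, so some graph on `m` vertices has `k` edges; its corona
  -- has `m + k`.
  have hchoose : k ≤ m.choose 2 := by
    have h1 := Nat.choose_le_choose 2 (show k + 1 ≤ m from hkm)
    rw [Nat.choose_succ_succ' k 1, Nat.choose_one_right] at h1
    omega
  have hle : m + k ≤ (m + m).choose 2 := by
    obtain ⟨H, -, hH⟩ := exists_isPendant m k hchoose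
    have h2 := ncard_edgeSet_add_compl H
    rw [Nat.card_fin] at h2
    omega
  have hgreat : IsGreatest (winnableSizes (m + m) ℓ) ((m + m).choose 2 - (m + k)) := by
    constructor
    · obtain ⟨H, hP, hH⟩ := exists_isPendant m k hchoose
      have h2 := ncard_edgeSet_add_compl H
      rw [Nat.card_fin] at h2
      refine ⟨Hᶜ, alwaysWinnable_of_isPendant hℓ0 hk3 ?_ (by rwa [compl_compl]) ?_, by omega⟩
      · rw [compl_compl, Nat.card_fin]
        omega
      · rw [Nat.card_fin]
        exact hk.1
    · rintro _ ⟨G, hG, rfl⟩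
      have h1 := (le_ncard_edgeSet_compl hℓ0 hℓ hk hk3 (Nat.card_fin _) hG).1
      have h2 := ncard_edgeSet_add_compl G
      rw [Nat.card_fin] at h2
      omega
  have hmax : maxSize (m + m) ℓ = (m + m).choose 2 - (m + k) := hgreat.csSup_eq
  have hcast : (((m + m).choose 2 - (m + k) : ℕ) : ℚ) =
      ((m + m).choose 2 : ℚ) - (((m + m : ℕ) : ℚ) / 2 + (k : ℚ)) := by
    rw [Nat.cast_sub hle]
    push_cast
    ring
  refine ⟨hmax ▸ hgreat, by rw [hmax, hcast], fun V _ G => ?_⟩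
  rw [← hcast, Nat.cast_inj, ← hmax]
  refine and_congr_right fun hV => and_congr_left fun hE => ?_
  have h2 := ncard_edgeSet_add_compl G
  rw [hV] at h2
  have hE' : Gᶜ.edgeSet.ncard = m + k := by omega
  constructor
  · exact fun hG => (le_ncard_edgeSet_compl hℓ0 hℓ hk hk3 hV hG).2 hE'
  · intro hP
    refine alwaysWinnable_of_isPendant hℓ0 hk3 ?_ hP ?_
    · rw [hV]
      omega
    · rw [hV]
      exact hk.1
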